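/- **Conventions.** For elements of a group, $x^g=g^{-1}xg$. $3^{1+2}_+$ is the extraspecial group of order $27$ and exponent $3$ (the Heisenberg group over $\mathbb F_3$, with $(x,y,z)(x',y',z')=(x+x',y+y',z+z'+xy')$), and $3^{1+2}_+:2^2$ is the semidirect product in which $2^2=\mathbb F_3^\times\times\mathbb F_3^\times$ acts faithfully by $(\varepsilon,\delta)\colon (x,y,z)\mapsto(\varepsilon x,\delta y,\varepsilon\delta z)$. A group $G=\langle a,b,c\rangle$ is a *triangle-point group* (with respect to $a,b,c$) if $a,b,c,ab$ have order $2$ and, for all $t,s\in a^G\cup b^G\cup c^G\cup(ab)^G$, the product $ts$ has order at most $6$. Let $V$ be a real inner product space with a commutative bilinear product $\cdot$ (not necessarily associative), and for $a\in V$ let $V_\mu^{(a)}=\{v: a\cdot v=\mu v\}$. A *Majorana axis* is a vector $a\in V$ such that - (M3) $(a,a)=1$ and $a\cdot a=a$; - (M4) $V=V_1^{(a)}\oplus V_0^{(a)}\oplus V_{1/2^2}^{(a)}\oplus V_{1/2^5}^{(a)}$; - (M5) $V_1^{(a)}=\mathbb R a$; - (M6) the linear map $\tau(a)$ of $V$ equal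 to $1$ on $V_1^{(a)}\oplus V_0^{(a)}\oplus V_{1/2^2}^{(a)}$ and to $-1$ on $V_{1/2^5}^{(a)}$ preserves the product; - (M7) the linear map $\sigma(a)$ of $V_+^{(a)}=V_1^{(a)}\oplus V_0^{(a)}\oplus V_{1/2^2}^{(a)}$ equal to $1$ on $V_1^{(a)}\oplus V_0^{(a)}$ and to $-1$ on $V_{1/2^2}^{(a)}$ preserves the restriction of the product to $V_+^{(a)}$. Two axes $a_0,a_1$ generate a subalgebra *of type $2A$* with third basis vector $a_\rho$ if $a_0,a_1,a_\rho$ are idempotents of length $1$ with pairwise inner products $\frac1{2^3}$, and $x\cdot y=\frac1{2^3}(x+y-z)$ whenever $\{x,y,z\}=\{a_0,a_1,a_\rho\}$. A *Majorana representation* $(G,T,V)$ consists of a finite group $G$; a $G$-stable set $T$ of involutions generating $G$; a real inner product space $V$ with a commutative bilinear product satisfying (M1) $(u,v\cdot w)=(u\cdot v,w)$ and (M2) $(u\cdot u,v\cdot v)\ge(u\cdot v,u\cdot v)$ for all $u,v,w\in V$; a linear representation $\varphi\colon G\to GL(V)$ preserving both products; and a bijection $\psi$ from $T$ onto a set of Majorana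 axes that generates the algebra $V$, such that $\psi(t^g)=\psi(t)^{\varphi(g)}$ and $\varphi(t)=\tau(\psi(t))$ for all $t\in T$, $g\in G$; and such that - (M8) for $t_0,t_1,t_2\in T$: if $\psi(t_0),\psi(t_1)$ generate a subalgebra of type $2A$ with third basis vector $a_\rho$, then $t_0t_1\in T$ and $\psi(t_0t_1)=a_\rho$; if $t_0t_1t_2=1$, then $\psi(t_0),\psi(t_1)$ generate a subalgebra of type $2A$ with third basis vector $\psi(t_2)$. **Proposition.** Let $G=\langle a,b,c\rangle\cong 2\times(3^{1+2}_+:2^2)$ be a triangle-point group with respect to $a,b,c$, and let $T\subseteq G$ with $a,b,c,ab\in T$. Then there exists no Majorana representation of the form $(G,T,V)$. Moreover, the subgroup $K=\langle a,b,(b\cdot c^{ac})^3\rangle$ is isomorphic to $2^3$, and $K\subseteq T\cup\{e\}$ whenever $T$ is $G$-stable and contains $(ts)^3$ for all $t,s\in T$ such that $ts$ has order $6$. -/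

import Mathlib

open scoped InnerProductSpace

/-! ## The group `2 × (3^{1+2}_+ : 2^2)` -/

/-- The Heisenberg group over `𝔽₃`, that is, the extraspecial group `3^{1+2}_+` of order `27` and
exponent `3`; `⟨x, y, z⟩` stands for the matrix with rows `(1, x, z)`, `(0, 1, y)`, `(0, 0, 1)`. -/
@[ext]
structure Heis3 : Type where
  x : ZMod 3
  y : ZMod 3
  z : ZMod 3
  deriving DecidableEq

namespace Heis3

instance : Mul Heis3 := ⟨fun g h => ⟨g.x + h.x, g.y + h.y, g.z + h.z + g.x * h.y⟩⟩

instance : One Heis3 := ⟨⟨0, 0, 0⟩⟩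

instance : Inv Heis3 := ⟨fun g => ⟨-g.x, -g.y, -g.z + g.x * g.y⟩⟩

@[simp] theorem mul_x (g h : Heis3) : (g * h).x = g.x + h.x := rfl
@[simp] theorem mul_y (g h : Heis3) : (g * h).y = g.y + h.y := rfl
@[simp] theorem mul_z (g h : Heis3) : (g * h).z = g.z + h.z + g.x * h.y := rfl
@[simp] theorem one_x : (1 : Heis3).x = 0 := rfl
@[simp] theorem one_y : (1 : Heis3).y = 0 := rfl
@[simp] theorem one_z : (1 : Heis3).z = 0 := rfl
@[simp] theorem inv_x (g : Heis3) : (g⁻¹).x = -g.x := rfl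
@[simp] theorem inv_y (g : Heis3) : (g⁻¹).y = -g.y := rfl
@[simp] theorem inv_z (g : Heis3) : (g⁻¹).z = -g.z + g.x * g.y := rfl

instance : Group Heis3 :=
  Group.ofLeftAxioms
    (fun g h k => by ext <;> simp <;> ring)
    (fun g => by ext <;> simp)
    (fun g => by ext <;> simp)

theorem unit_mul_self (u : (ZMod 3)ˣ) : (u : ZMod 3) * u = 1 := by
  revert u; decide

/-- The automorphism `(x, y, z) ↦ (ε x, δ y, ε δ z)`, which is its own inverse. -/
def diagAut (u : (ZMod 3)ˣ × (ZMod 3)ˣ) : Heis3 ≃* Heis3 where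
  toFun g := ⟨u.1 * g.x, u.2 * g.y, u.1 * u.2 * g.z⟩
  invFun g := ⟨u.1 * g.x, u.2 * g.y, u.1 * u.2 * g.z⟩
  left_inv g := by
    have h1 := unit_mul_self u.1
    have h2 := unit_mul_self u.2
    ext
    · linear_combination g.x * h1
    · linear_combination g.y * h2
    · linear_combination (u.2 : ZMod 3) * u.2 * g.z * h1 + g.z * h2
  right_inv g := by
    have h1 := unit_mul_self u.1
    have h2 := unit_mul_self u.2
    ext
    · linear_combination g.x * h1
    · linear_combination g.y * h2
    · linear_combination (u.2 : ZMod 3) * u.2 * g.z * h1 + g.z * h2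
  map_mul' g h := by ext <;> simp <;> ring

/-- The (faithful) action of `2^2 = 𝔽₃ˣ × 𝔽₃ˣ` on `3^{1+2}_+` by diagonal automorphisms. -/
def diagAction : (ZMod 3)ˣ × (ZMod 3)ˣ →* MulAut Heis3 where
  toFun := diagAut
  map_one' := by
    apply MulEquiv.ext
    intro g
    apply Heis3.ext
    · exact one_mul g.x
    · exact one_mul g.y
    · change (1 : ZMod 3) * 1 * g.z = g.z
      ring
  map_mul' u v := by
    apply MulEquiv.ext
    intro g
    apply Heis3.ext
    · exact mul_assoc (u.1 : ZMod 3) v.1 g.x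
    · exact mul_assoc (u.2 : ZMod 3) v.2 g.y
    · change ((u.1 : ZMod 3) * v.1) * (u.2 * v.2) * g.z = u.1 * u.2 * (v.1 * v.2 * g.z)
      ring

end Heis3

/-- The group `2 × (3^{1+2}_+ : 2^2)` of order `216`. -/
abbrev TwoTimesHeisKlein : Type :=
  Multiplicative (ZMod 2) × (Heis3 ⋊[Heis3.diagAction] ((ZMod 3)ˣ × (ZMod 3)ˣ))

/-! ## Triangle-point groups -/

/-- `x ^ g = g⁻¹ x g`. -/
def conjBy {G : Type*} [Group G] (x g : G) : G := g⁻¹ * x * g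

/-- `G` is a triangle-point group with respect to the generators `a`, `b`, `c`. -/
structure IsTrianglePoint {G : Type*} [Group G] (a b c : G) : Prop where
  closure_eq_top : Subgroup.closure {a, b, c} = ⊤
  orderOf_a : orderOf a = 2
  orderOf_b : orderOf b = 2
  orderOf_c : orderOf c = 2
  orderOf_ab : orderOf (a * b) = 2
  orderOf_mul_le : ∀ t ∈ Group.conjugatesOfSet {a, b, c, a * b},
    ∀ s ∈ Group.conjugatesOfSet {a, b, c, a * b},
      0 < orderOf (t * s) ∧ orderOf (t * s) ≤ 6

/-! ## Majorana axes and Majorana representations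

Throughout, a bilinear product on a real vector space `V` is a map `m : V →ₗ[ℝ] V →ₗ[ℝ] V`. -/

namespace Majorana

section Basic

variable {V : Type*} [AddCommGroup V] [Module ℝ V]

/-- The `μ`-eigenspace of the adjoint action of `a`. -/
def eig (m : V →ₗ[ℝ] V →ₗ[ℝ] V) (a : V) (μ : ℝ) : Submodule ℝ V :=
  Module.End.eigenspace (m a) μ

/-- The four eigenvalues `1`, `0`, `1/2^2`, `1/2^5`. -/
noncomputable def eigenvalue : Fin 4 → ℝ := ![1, 0, 1 / 2 ^ 2, 1 / 2 ^ 5]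

/-- `V₊ = V₁ ⊕ V₀ ⊕ V_{1/4}`. -/
noncomputable def plusPart (m : V →ₗ[ℝ] V →ₗ[ℝ] V) (a : V) : Submodule ℝ V :=
  eig m a 1 ⊔ eig m a 0 ⊔ eig m a (1 / 2 ^ 2)

/-- `τ` acts on the eigenspaces of `a` as the map `τ(a)`. -/
structure IsTau (m : V →ₗ[ℝ] V →ₗ[ℝ] V) (a : V) (τ : V →ₗ[ℝ] V) : Prop where
  one : ∀ u ∈ eig m a 1, τ u = u
  zero : ∀ u ∈ eig m a 0, τ u = u
  quarter : ∀ u ∈ eig m a (1 / 2 ^ 2), τ u = u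
  thirtysecond : ∀ u ∈ eig m a (1 / 2 ^ 5), τ u = -u

/-- `σ` acts on the eigenspaces of `a` in `V₊` as the map `σ(a)`. -/
structure IsSigma (m : V →ₗ[ℝ] V →ₗ[ℝ] V) (a : V)
    (σ : plusPart m a →ₗ[ℝ] plusPart m a) : Prop where
  one : ∀ u : plusPart m a, (u : V) ∈ eig m a 1 → σ u = u
  zero : ∀ u : plusPart m a, (u : V) ∈ eig m a 0 → σ u = u
  quarter : ∀ u : plusPart m a, (u : V) ∈ eig m a (1 / 2 ^ 2) → σ u = -u

/-- The smallest subalgebra of `(V, m)` that contains `B`. -/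
def generated (m : V →ₗ[ℝ] V →ₗ[ℝ] V) (B : Set V) : Submodule ℝ V :=
  sInf {U : Submodule ℝ V | B ⊆ U ∧ ∀ u ∈ U, ∀ v ∈ U, m u v ∈ U}

end Basic

variable {V : Type*} [NormedAddCommGroup V] [InnerProductSpace ℝ V]

/-- The axioms (M3)–(M7): `a` is a Majorana axis of `(V, m)`. -/
structure IsAxis (m : V →ₗ[ℝ] V →ₗ[ℝ] V) (a : V) : Prop where
  inner_self : ⟪a, a⟫_ℝ = 1
  idem : m a a = a
  isInternal : DirectSum.IsInternal (fun i : Fin 4 => eig m a (eigenvalue i))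
  primitive : eig m a 1 = Submodule.span ℝ {a}
  tau : ∃ τ : V →ₗ[ℝ] V, IsTau m a τ ∧ ∀ u v, m (τ u) (τ v) = τ (m u v)
  sigma : ∃ σ : plusPart m a →ₗ[ℝ] plusPart m a, IsSigma m a σ ∧
    ∀ u v : plusPart m a, ∃ w : plusPart m a, m (u : V) (v : V) = w ∧
      m (σ u : V) (σ v : V) = σ w

/-- The subalgebra generated by `a₀` and `a₁` is a dihedral algebra of type `2A` whose basis is
`a₀, a₁, aρ`. (The Gram matrix makes the three vectors linearly independent, and their products
show that they span the subalgebra generated by `a₀` and `a₁`.) -/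
structure IsType2A (m : V →ₗ[ℝ] V →ₗ[ℝ] V) (a₀ a₁ aρ : V) : Prop where
  mul_01 : m a₀ a₁ = (1 / 2 ^ 3 : ℝ) • (a₀ + a₁ - aρ)
  mul_0ρ : m a₀ aρ = (1 / 2 ^ 3 : ℝ) • (a₀ + aρ - a₁)
  mul_1ρ : m a₁ aρ = (1 / 2 ^ 3 : ℝ) • (a₁ + aρ - a₀)
  mul_00 : m a₀ a₀ = a₀
  mul_11 : m a₁ a₁ = a₁
  mul_ρρ : m aρ aρ = aρ
  inner_01 : ⟪a₀, a₁⟫_ℝ = 1 / 2 ^ 3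
  inner_0ρ : ⟪a₀, aρ⟫_ℝ = 1 / 2 ^ 3
  inner_1ρ : ⟪a₁, aρ⟫_ℝ = 1 / 2 ^ 3
  inner_00 : ⟪a₀, a₀⟫_ℝ = 1
  inner_11 : ⟪a₁, a₁⟫_ℝ = 1
  inner_ρρ : ⟪aρ, aρ⟫_ℝ = 1

end Majorana

open Majorana in
/-- A Majorana representation `(G, T, V, ·, (,), φ, ψ)` satisfying (M1)–(M8), the inner product
being that of `V`. The set of Majorana axes is the range of `ψ`. Group elements act on `V` from the
left, so that `ψ(t^g) = ψ(t)^{φ(g)}` reads `ψ(g t g⁻¹) = φ(g) ψ(t)`. -/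
structure MajoranaRepresentation (G : Type*) [Group G] (T : Set G)
    (V : Type*) [NormedAddCommGroup V] [InnerProductSpace ℝ V] where
  finite_group : Finite G
  involution : ∀ t ∈ T, orderOf t = 2
  conj_mem : ∀ (g : G), ∀ t ∈ T, g * t * g⁻¹ ∈ T
  closure_eq_top : Subgroup.closure T = ⊤
  /-- the algebra product -/
  mul : V →ₗ[ℝ] V →ₗ[ℝ] V
  mul_comm : ∀ u v, mul u v = mul v u
  /-- (M1) -/
  inner_assoc : ∀ u v w, ⟪u, mul v w⟫_ℝ = ⟪mul u v, w⟫_ℝ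
  /-- (M2), the Norton inequality -/
  norton : ∀ u v, ⟪mul u v, mul u v⟫_ℝ ≤ ⟪mul u u, mul v v⟫_ℝ
  φ : Representation ℝ G V
  φ_mul : ∀ g u v, mul (φ g u) (φ g v) = φ g (mul u v)
  φ_inner : ∀ g u v, ⟪φ g u, φ g v⟫_ℝ = ⟪u, v⟫_ℝ
  ψ : T → V
  ψ_injective : Function.Injective ψ
  /-- (M3)–(M7) -/
  ψ_isAxis : ∀ t, IsAxis mul (ψ t)
  generated_eq_top : generated mul (Set.range ψ) = ⊤
  ψ_conj : ∀ (g : G) (t : T), ψ ⟨g * t * g⁻¹, conj_mem g t t.2⟩ = φ g (ψ t)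
  /-- `φ(t)` is the Majorana involution `τ(ψ(t))` -/
  φ_eq_tau : ∀ t : T, IsTau mul (ψ t) (φ t)
  /-- (M8), first part -/
  mem_of_type2A : ∀ (t₀ t₁ : T) (w : V), IsType2A mul (ψ t₀) (ψ t₁) w →
    ∃ h : (t₀ : G) * t₁ ∈ T, ψ ⟨(t₀ : G) * t₁, h⟩ = w
  /-- (M8), second part -/
  type2A_of_mul_eq_one : ∀ t₀ t₁ t₂ : T, (t₀ : G) * t₁ * t₂ = 1 →
    IsType2A mul (ψ t₀) (ψ t₁) (ψ t₂)

/-! An elementary abelian group of order 8 cannot have all seven involutions in `T`. Indeed all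
pairs of axes would be of type 2A, so for a fixed u the differences ψ(x) - ψ(ux) are
1/4-eigenvectors of ψ(u). Up to a factor, the product of two such differences is a third. The fusion
rule sends 1/4 · 1/4 into the eigenvalues 1 and 0, so this product vanishes and two distinct
involutions share an axis (`false_of_elementary_abelian`).

Such a subgroup is forced here. The quotient of G by 3^{1+2} is 2^3, generated by the images of a,
b, c, and an involution is determined up to conjugacy by its image. The elements a, b, ab, c cover
four of the seven nontrivial images. The products ac, bc, abc have order 6, and their cubes cover
the other three (`symm_lift_mem`).

It remains that `T` contains these cubes (`pow_three_mem`). The cube of ts is a product of two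
commuting members of `T`, opposite in the hexagon of axes of ⟨t, s⟩. Commuting axes are of type 2A,
which puts the product in `T`, or have product zero. In the latter case multiplications by opposite
axes commute on suitable vectors, which determines the inner product of adjacent axes and
contradicts the values possible at distance two (`false_of_hexagon`). -/

namespace Majorana

/-! ### Eigenvectors and fusion rules of a single axis. -/

variable {V : Type*} [NormedAddCommGroup V] [InnerProductSpace ℝ V]
  {m : V →ₗ[ℝ] V →ₗ[ℝ] V} {a : V} {τ : V →ₗ[ℝ] V}

theorem mem_eig {m : V →ₗ[ℝ] V →ₗ[ℝ] V} {a x : V} {μ : ℝ} : x ∈ eig m a μ ↔ m a x = μ • x :=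
  Module.End.mem_eigenspace_iff

theorem IsAxis.exists_eigen_decomposition (h : IsAxis m a) (x : V) :
    ∃ r : ℝ, ∃ x₀ x₁ x₂ : V, x = r • a + x₀ + x₁ + x₂ ∧ m a x₀ = 0 ∧
      m a x₁ = (1 / 4 : ℝ) • x₁ ∧ m a x₂ = (1 / 32 : ℝ) • x₂ := by
  have hx : x ∈ ⨆ i : Fin 4, eig m a (eigenvalue i) := by
    rw [h.isInternal.submodule_iSup_eq_top]; trivial
  rw [Submodule.mem_iSup_iff_exists_finsupp] at hx
  obtain ⟨f, hf, rfl⟩ := hx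
  rw [Finsupp.sum_fintype _ _ (fun _ => rfl)]
  have h0 := hf 0
  have h1 := mem_eig.1 (hf 1)
  have h2 := mem_eig.1 (hf 2)
  have h3 := mem_eig.1 (hf 3)
  simp only [eigenvalue, Matrix.cons_val] at h0 h1 h2 h3
  rw [h.primitive, Submodule.mem_span_singleton] at h0
  obtain ⟨r, hr⟩ := h0
  refine ⟨r, f 1, f 2, f 3, ?_, ?_, ?_, ?_⟩
  · rw [hr, Fin.sum_univ_four]
  · simpa using h1
  · rw [h2]; norm_num
  · rw [h3]; norm_num

/-- Multiplication by `a` is self-adjoint, so its eigenspaces for distinct eigenvalues are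
orthogonal. -/
theorem inner_eq_zero_of_eigen (hm : ∀ u v w, ⟪u, m v w⟫_ℝ = ⟪m u v, w⟫_ℝ) (h : IsAxis m a)
    {x : V} {μ : ℝ} (hμ : μ ≠ 1) (hx : m a x = μ • x) : ⟪a, x⟫_ℝ = 0 := by
  have h1 := hm a a x
  rw [hx, h.idem, inner_smul_right] at h1
  have : (μ - 1) * ⟪a, x⟫_ℝ = 0 := by linarith
  exact (mul_eq_zero.1 this).resolve_left (sub_ne_zero.2 hμ)

theorem IsTau.eigen_decomposition (hm : ∀ u v w, ⟪u, m v w⟫_ℝ = ⟪m u v, w⟫_ℝ) (h : IsAxis m a)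
    (hτ : IsTau m a τ) {x : V} (hx : τ x = x) :
    ∃ x₀ x₁ : V, x = ⟪a, x⟫_ℝ • a + x₀ + x₁ ∧ m a x₀ = 0 ∧ m a x₁ = (1 / 4 : ℝ) • x₁ := by
  obtain ⟨r, x₀, x₁, x₂, rfl, h0, h1, h2⟩ := h.exists_eigen_decomposition x
  have e : ⟪a, r • a + x₀ + x₁ + x₂⟫_ℝ = r := by
    rw [inner_add_right, inner_add_right, inner_add_right, inner_smul_right, h.inner_self,
      inner_eq_zero_of_eigen hm h (by norm_num : (0 : ℝ) ≠ 1) (by simpa using h0),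
      inner_eq_zero_of_eigen hm h (by norm_num : (1 / 4 : ℝ) ≠ 1) h1,
      inner_eq_zero_of_eigen hm h (by norm_num : (1 / 32 : ℝ) ≠ 1) h2]
    ring
  have h2' : x₂ = 0 := by
    simp only [map_add, map_smul] at hx
    rw [hτ.one a (mem_eig.2 (by simpa using h.idem)), hτ.zero x₀ (mem_eig.2 (by simpa using h0)),
      hτ.quarter x₁ (mem_eig.2 (by rw [h1]; norm_num)),
      hτ.thirtysecond x₂ (mem_eig.2 (by rw [h2]; norm_num))] at hx
    have : -x₂ = x₂ := add_left_cancel hx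
    have h3 : (2 : ℝ) • x₂ = 0 := by rw [two_smul]; nth_rewrite 1 [← this]; exact neg_add_cancel x₂
    exact (smul_eq_zero.1 h3).resolve_left two_ne_zero
  refine ⟨x₀, x₁, ?_, h0, h1⟩
  rw [e, h2', add_zero]

/-- `x - τ x` is twice the 1/32-component of `x`. -/
theorem IsTau.mul_sub (h : IsAxis m a) (hτ : IsTau m a τ) (x : V) :
    m a (x - τ x) = (1 / 32 : ℝ) • (x - τ x) := by
  obtain ⟨r, x₀, x₁, x₂, rfl, h0, h1, h2⟩ := h.exists_eigen_decomposition x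
  simp only [map_add, map_smul, map_sub]
  rw [hτ.one a (mem_eig.2 (by simpa using h.idem)), hτ.zero x₀ (mem_eig.2 (by simpa using h0)),
      hτ.quarter x₁ (mem_eig.2 (by rw [h1]; norm_num)),
      hτ.thirtysecond x₂ (mem_eig.2 (by rw [h2]; norm_num)), map_neg, h2]
  module

/-- The projection of `V₊` onto the `1/4`-eigenspace of `a`, as a linear map on `V`. -/
noncomputable def quarterPart (m : V →ₗ[ℝ] V →ₗ[ℝ] V) (a : V) : V →ₗ[ℝ] V :=
  (4 : ℝ) • (m a - (innerₛₗ ℝ a).smulRight a)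

theorem quarterPart_apply (x : V) : quarterPart m a x = (4 : ℝ) • (m a x - ⟪a, x⟫_ℝ • a) := by
  simp [quarterPart]

theorem mul_eq_quarterPart (x : V) :
    m a x = ⟪a, x⟫_ℝ • a + (1 / 4 : ℝ) • quarterPart m a x := by
  rw [quarterPart_apply]; module

/-- The axiom (M7) for products of eigenvectors in `V₊`. -/
theorem IsAxis.sigma_mul (h : IsAxis m a) {u v : V} {ε δ : ℝ}
    (hu : m a u = 0 ∧ ε = 1 ∨ m a u = (1 / 4 : ℝ) • u ∧ ε = -1)
    (hv : m a v = 0 ∧ δ = 1 ∨ m a v = (1 / 4 : ℝ) • v ∧ δ = -1) :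
    ∃ r : ℝ, ∃ w₀ w₁ : V, m u v = r • a + w₀ + w₁ ∧ m a w₀ = 0 ∧ m a w₁ = (1 / 4 : ℝ) • w₁ ∧
      (ε * δ) • m u v = r • a + w₀ - w₁ := by
  obtain ⟨σ, hσ, hmul⟩ := h.sigma
  have key : ∀ {u : V} {ε : ℝ}, (m a u = 0 ∧ ε = 1 ∨ m a u = (1 / 4 : ℝ) • u ∧ ε = -1) →
      ∃ hu : u ∈ plusPart m a, σ ⟨u, hu⟩ = ε • ⟨u, hu⟩ := by
    rintro u ε (⟨h0, rfl⟩ | ⟨h1, rfl⟩)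
    · have e : u ∈ eig m a 0 := mem_eig.2 (by simpa using h0)
      have hp : u ∈ plusPart m a := Submodule.mem_sup_left (Submodule.mem_sup_right e)
      exact ⟨hp, by rw [hσ.zero ⟨u, hp⟩ e, one_smul]⟩
    · have e : u ∈ eig m a (1 / 2 ^ 2) := mem_eig.2 (by rw [h1]; norm_num)
      have hp : u ∈ plusPart m a := Submodule.mem_sup_right e
      exact ⟨hp, by rw [hσ.quarter ⟨u, hp⟩ e, neg_one_smul]⟩
  obtain ⟨hu', eu⟩ := key hu
  obtain ⟨hv', ev⟩ := key hv
  obtain ⟨⟨w, hw⟩, h1, h2⟩ := hmul ⟨u, hu'⟩ ⟨v, hv'⟩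
  simp only at h1
  rw [eu, ev] at h2
  simp only [Submodule.coe_smul, map_smul, LinearMap.smul_apply, h1] at h2
  have hw' := hw
  obtain ⟨w', hw1, w₁, hw₁, rfl⟩ := Submodule.mem_sup.1 hw'
  obtain ⟨x, hx, w₀, hw₀, rfl⟩ := Submodule.mem_sup.1 hw1
  have hx' := hx
  rw [h.primitive, Submodule.mem_span_singleton] at hx'
  obtain ⟨r, rfl⟩ := hx'
  have p1 : r • a ∈ plusPart m a := Submodule.mem_sup_left (Submodule.mem_sup_left hx)
  have p2 : w₀ ∈ plusPart m a := Submodule.mem_sup_left (Submodule.mem_sup_right hw₀)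
  have p3 : w₁ ∈ plusPart m a := Submodule.mem_sup_right hw₁
  have e : (⟨r • a + w₀ + w₁, hw⟩ : plusPart m a) = ⟨r • a, p1⟩ + ⟨w₀, p2⟩ + ⟨w₁, p3⟩ := rfl
  refine ⟨r, w₀, w₁, h1, by simpa using mem_eig.1 hw₀, by rw [mem_eig.1 hw₁]; norm_num, ?_⟩
  rw [e, map_add, map_add, hσ.one ⟨_, p1⟩ hx, hσ.zero ⟨_, p2⟩ hw₀, hσ.quarter ⟨_, p3⟩ hw₁] at h2
  rw [h1, mul_smul, smul_comm, h2]
  simp [sub_eq_add_neg]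

/-- Invariance under σ removes the 1/4-component of the product; associativity of the form removes
the component along `a`. -/
theorem IsAxis.mul_zero_zero (hm : ∀ u v w, ⟪u, m v w⟫_ℝ = ⟪m u v, w⟫_ℝ) (h : IsAxis m a)
    {u v : V} (hu : m a u = 0) (hv : m a v = 0) : m a (m u v) = 0 := by
  obtain ⟨r, w₀, w₁, e, h0, h1, e'⟩ := h.sigma_mul (.inl ⟨hu, rfl⟩) (.inl ⟨hv, rfl⟩)
  have hw : w₁ = 0 := by
    have : (2 : ℝ) • w₁ = 0 := by
      rw [one_mul, one_smul, e] at e'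
      linear_combination (norm := module) e'
    exact (smul_eq_zero.1 this).resolve_left two_ne_zero
  have hr : r = 0 := by
    have h2 : ⟪a, m u v⟫_ℝ = 0 := by rw [hm, hu, inner_zero_left]
    rw [e, hw, add_zero, inner_add_right, inner_smul_right, h.inner_self,
      inner_eq_zero_of_eigen hm h (by norm_num : (0 : ℝ) ≠ 1) (by simpa using h0)] at h2
    linarith
  rw [e, hw, hr, zero_smul, zero_add, add_zero, h0]

theorem IsAxis.mul_zero_quarter (h : IsAxis m a) {u v : V} (hu : m a u = 0)
    (hv : m a v = (1 / 4 : ℝ) • v) : m a (m u v) = (1 / 4 : ℝ) • m u v := by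
  obtain ⟨r, w₀, w₁, e, h0, h1, e'⟩ := h.sigma_mul (.inl ⟨hu, rfl⟩) (.inr ⟨hv, rfl⟩)
  have : m u v = w₁ := by
    have : (2 : ℝ) • (m u v - w₁) = 0 := by linear_combination (norm := module) e - e'
    exact sub_eq_zero.1 ((smul_eq_zero.1 this).resolve_left two_ne_zero)
  rw [this, h1]

theorem IsAxis.mul_quarter_quarter (h : IsAxis m a) {u v : V} (hu : m a u = (1 / 4 : ℝ) • u)
    (hv : m a v = (1 / 4 : ℝ) • v) : ∃ r : ℝ, ∃ w₀ : V, m u v = r • a + w₀ ∧ m a w₀ = 0 := by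
  obtain ⟨r, w₀, w₁, e, h0, h1, e'⟩ := h.sigma_mul (.inr ⟨hu, rfl⟩) (.inr ⟨hv, rfl⟩)
  refine ⟨r, w₀, ?_, h0⟩
  have : (2 : ℝ) • (m u v - (r • a + w₀)) = 0 := by linear_combination (norm := module) e + e'
  exact sub_eq_zero.1 ((smul_eq_zero.1 this).resolve_left two_ne_zero)

/-- A product of `1/4`-eigenvectors that is again a `1/4`-eigenvector vanishes. -/
theorem IsAxis.mul_eq_zero_of_quarter (hm : ∀ u v w, ⟪u, m v w⟫_ℝ = ⟪m u v, w⟫_ℝ)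
    (h : IsAxis m a) {u v : V} (hu : m a u = (1 / 4 : ℝ) • u)
    (hv : m a v = (1 / 4 : ℝ) • v) (huv : m a (m u v) = (1 / 4 : ℝ) • m u v) : m u v = 0 := by
  obtain ⟨r, w₀, e, h0⟩ := h.mul_quarter_quarter hu hv
  have hr : r = 0 := by
    have h2 := inner_eq_zero_of_eigen hm h (by norm_num : (1 / 4 : ℝ) ≠ 1) huv
    rw [e, inner_add_right, inner_smul_right, h.inner_self,
      inner_eq_zero_of_eigen hm h (by norm_num : (0 : ℝ) ≠ 1) (by simpa using h0)] at h2
    linarith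
  rw [e, hr, zero_smul, zero_add, h0] at huv
  rw [e, hr, zero_smul, zero_add]
  exact (smul_eq_zero.1 huv.symm).resolve_left (by norm_num)

/-- Multiplication by a `0`-eigenvector commutes with multiplication by the axis. -/
theorem IsTau.mul_mul_comm (hm : ∀ u v w, ⟪u, m v w⟫_ℝ = ⟪m u v, w⟫_ℝ)
    (hc : ∀ u v, m u v = m v u) (h : IsAxis m a)
    (hτ : IsTau m a τ) {u x : V} (hu : m a u = 0) (hx : τ x = x) :
    m a (m u x) = m u (m a x) := by
  obtain ⟨x₀, x₁, e, h0, h1⟩ := hτ.eigen_decomposition hm h hx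
  rw [e]
  simp only [map_add, map_smul, hc u a, hu, h0, h1, h.mul_zero_zero hm hu h0,
    h.mul_zero_quarter hu h1, h.idem, smul_zero, map_zero]

theorem IsTau.mul_quarterPart (hm : ∀ u v w, ⟪u, m v w⟫_ℝ = ⟪m u v, w⟫_ℝ)
    (h : IsAxis m a) (hτ : IsTau m a τ) {x : V} (hx : τ x = x) :
    m a (quarterPart m a x) = (1 / 4 : ℝ) • quarterPart m a x ∧
      m a (x - ⟪a, x⟫_ℝ • a - quarterPart m a x) = 0 := by
  obtain ⟨x₀, x₁, e, h0, h1⟩ := hτ.eigen_decomposition hm h hx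
  have e1 : quarterPart m a x = x₁ := by
    have : m a x = ⟪a, x⟫_ℝ • a + (1 / 4 : ℝ) • x₁ := by
      nth_rewrite 1 [e]
      simp only [map_add, map_smul, h0, h1, h.idem, add_zero]
    rw [quarterPart_apply, this]; module
  have e2 : x - ⟪a, x⟫_ℝ • a - quarterPart m a x = x₀ := by
    rw [e1]; nth_rewrite 1 [e]; module
  rw [e2, e1]
  exact ⟨h1, h0⟩

/-- Write x = l a + z + y with z, y in the eigenspaces 0 and 1/4. By fusion, zz and yy have no
1/4-part and zy is its own, so the 1/4-part of xx is twice that of xy. Both identities avoid z, so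
they can be used when only products with x are known. -/
theorem IsTau.quarterPart_mul_quarterPart (hm : ∀ u v w, ⟪u, m v w⟫_ℝ = ⟪m u v, w⟫_ℝ)
    (hc : ∀ u v, m u v = m v u) (h : IsAxis m a) (hτ : IsTau m a τ) {x : V} (hx : τ x = x) :
    quarterPart m a (m x (quarterPart m a x)) = (1 / 2 : ℝ) • quarterPart m a (m x x) ∧
      m (quarterPart m a x) (quarterPart m a x) =
        m x (quarterPart m a x) - quarterPart m a (m x (quarterPart m a x)) := by
  obtain ⟨h1, h0⟩ := hτ.mul_quarterPart hm h hx
  set y := quarterPart m a x with hy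
  set l := ⟪a, x⟫_ℝ
  set z := x - l • a - y with hz
  have hx : x = l • a + z + y := by rw [hz]; module
  obtain ⟨r, w, e, hw⟩ := h.mul_quarter_quarter h1 h1
  have q0 : ∀ {w : V}, m a w = 0 → quarterPart m a w = 0 := fun {w} hw => by
    rw [quarterPart_apply, hw,
      inner_eq_zero_of_eigen hm h (by norm_num : (0 : ℝ) ≠ 1) (by simpa using hw)]
    simp
  have qa : quarterPart m a a = 0 := by
    rw [quarterPart_apply, h.idem, h.inner_self]; simp
  have qyy : quarterPart m a (m y y) = 0 := by
    rw [e, map_add, map_smul, qa, q0 hw]; simp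
  have qzz := q0 (h.mul_zero_zero hm h0 h0)
  have q1 : ∀ {w : V}, m a w = (1 / 4 : ℝ) • w → quarterPart m a w = w := fun {w} hw => by
    rw [quarterPart_apply, hw, inner_eq_zero_of_eigen hm h (by norm_num : (1 / 4 : ℝ) ≠ 1) hw]
    module
  have qzy := q1 (h.mul_zero_quarter h0 h1)
  rw [hx]
  simp only [map_add, map_smul, LinearMap.add_apply, LinearMap.smul_apply, hc z a, hc y a, hc y z,
    h0, h1, h.idem, qa, qyy, qzz, qzy, q1 h1, map_zero]
  constructor <;> module

end Majorana

/-! ### Dihedral configurations of axes. -/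

namespace Majorana

variable {V : Type*} [NormedAddCommGroup V] [InnerProductSpace ℝ V]
  {m : V →ₗ[ℝ] V →ₗ[ℝ] V} {a b : V} {τ ρ : V →ₗ[ℝ] V}

/-- The vector `a · b - (a + b) / 2^5`. -/
noncomputable def sVec (m : V →ₗ[ℝ] V →ₗ[ℝ] V) (a b : V) : V :=
  m a b - (1 / 32 : ℝ) • (a + b)

theorem sVec_comm (hc : ∀ u v, m u v = m v u) (a b : V) : sVec m a b = sVec m b a := by
  rw [sVec, sVec, hc, add_comm]

/-- The coefficient 1/32 in `sVec` is chosen for this: `b - τ b` is a 1/32-eigenvector. In a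
dihedral configuration many pairs therefore share one vector. -/
theorem IsTau.sVec_eq (h : IsAxis m a) (hτ : IsTau m a τ) (b : V) :
    sVec m a (τ b) = sVec m a b := by
  have := hτ.mul_sub h b
  rw [map_sub] at this
  rw [sVec, sVec]
  linear_combination (norm := module) -this

theorem IsTau.inner_eq (hm : ∀ u v w, ⟪u, m v w⟫_ℝ = ⟪m u v, w⟫_ℝ) (h : IsAxis m a)
    (hτ : IsTau m a τ) (b : V) : ⟪a, τ b⟫_ℝ = ⟪a, b⟫_ℝ := by
  have := inner_eq_zero_of_eigen hm h (by norm_num) (hτ.mul_sub h b)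
  rw [inner_sub_right] at this
  linarith

theorem mul_eq_sVec (a b : V) : m a b = sVec m a b + (1 / 32 : ℝ) • (a + b) := by
  rw [sVec]; module

theorem IsTau.quarterPart_add (hm : ∀ u v w, ⟪u, m v w⟫_ℝ = ⟪m u v, w⟫_ℝ) (h : IsAxis m a)
    (hτ : IsTau m a τ) (b : V) : quarterPart m a (b + τ b) =
      (8 : ℝ) • sVec m a b + (1 / 4 - 8 * ⟪a, b⟫_ℝ) • a + (1 / 8 : ℝ) • (b + τ b) := by
  rw [quarterPart_apply, inner_add_right, hτ.inner_eq hm h, map_add, mul_eq_sVec a b,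
    mul_eq_sVec a (τ b), hτ.sVec_eq h]
  module

/-- The product of an axis `a` and the vector `a · b - (a + b) / 2^5`. -/
theorem IsTau.mul_sVec (hm : ∀ u v w, ⟪u, m v w⟫_ℝ = ⟪m u v, w⟫_ℝ) (h : IsAxis m a)
    (hτ : IsTau m a τ) (hb : τ (τ b) = b) : m a (sVec m a b) =
      (7 / 32 : ℝ) • sVec m a b + (3 / 4 * ⟪a, b⟫_ℝ - 25 / 1024) • a +
        (7 / 2048 : ℝ) • (b + τ b) := by
  -- The 1/4-part of the τ-fixed vector `b + τ b` involves `sVec m a b`; solving its eigenvector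
  -- equation gives the product.
  have h1 := (hτ.mul_quarterPart hm h (x := b + τ b) (by rw [map_add, hb, add_comm])).1
  rw [hτ.quarterPart_add hm h] at h1
  simp only [map_add, map_smul, h.idem] at h1
  rw [mul_eq_sVec a b, mul_eq_sVec a (τ b), hτ.sVec_eq h] at h1
  linear_combination (norm := module) (1 / 8 : ℝ) • h1

/-- For idempotents the Norton inequality reads (ab, ab) ≤ (a, b). -/
theorem IsAxis.inner_nonneg (hn : ∀ u v, ⟪m u v, m u v⟫_ℝ ≤ ⟪m u u, m v v⟫_ℝ)
    (ha : IsAxis m a) (hb : IsAxis m b) : 0 ≤ ⟪a, b⟫_ℝ := by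
  have := hn a b
  rw [ha.idem, hb.idem] at this
  exact real_inner_self_nonneg.trans this

theorem IsAxis.inner_ne_one (ha : IsAxis m a) (hb : IsAxis m b) (hab : a ≠ b) :
    ⟪a, b⟫_ℝ ≠ 1 := fun h => hab <|
  (inner_eq_one_iff_of_norm_eq_one (𝕜 := ℝ)
    (by rw [norm_eq_sqrt_real_inner, ha.inner_self, Real.sqrt_one])
    (by rw [norm_eq_sqrt_real_inner, hb.inner_self, Real.sqrt_one])).1 h

theorem IsAxis.inner_lt_one (ha : IsAxis m a) (hb : IsAxis m b) (hab : a ≠ b) :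
    ⟪a, b⟫_ℝ < 1 := by
  refine lt_of_le_of_ne ?_ (ha.inner_ne_one hb hab)
  have := real_inner_le_norm a b
  rwa [norm_eq_sqrt_real_inner, norm_eq_sqrt_real_inner, ha.inner_self, hb.inner_self,
    Real.sqrt_one, one_mul] at this

/-- Two distinct axes whose involutions fix each other are of type `2A` or `2B`. -/
theorem type2A_or_type2B (hm : ∀ u v w, ⟪u, m v w⟫_ℝ = ⟪m u v, w⟫_ℝ)
    (hc : ∀ u v, m u v = m v u) (ha : IsAxis m a) (hb : IsAxis m b) (hτ : IsTau m a τ)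
    (hρ : IsTau m b ρ) (hab : a ≠ b) (h1 : τ b = b) (h2 : ρ a = a) :
    (∃ w, IsType2A m a b w) ∨ m a b = 0 := by
  obtain ⟨l, hl⟩ : ∃ l, l = ⟪a, b⟫_ℝ := ⟨_, rfl⟩
  have hl' : ⟪b, a⟫_ℝ = l := by rw [hl, real_inner_comm]
  obtain ⟨y, hy⟩ : ∃ y, y = quarterPart m a b := ⟨_, rfl⟩
  have hy1 := (hτ.mul_quarterPart hm ha h1).1
  obtain ⟨hy2, eyy⟩ := hτ.quarterPart_mul_quarterPart hm hc ha h1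
  have hz := (hρ.mul_quarterPart hm hb h2).1
  have eab : m a b = l • a + (1 / 4 : ℝ) • y := by rw [mul_eq_quarterPart, hl, hy]
  have eba : m b a = l • a + (1 / 4 : ℝ) • y := by rw [hc, eab]
  have ez : quarterPart m b a = y + (4 * l) • a - (4 * l) • b := by
    rw [quarterPart_apply, hc b a, eab, hl']; module
  rw [← hy] at hy1 hy2 eyy
  rw [ez] at hz
  simp only [map_add, map_sub, map_smul, hb.idem, eba] at hz
  -- The roles of `a` and `b` are exchanged: the 1/4-part of `a` with respect to `b` is again a
  -- combination of `y`, `a`, `b`, and its eigenvector equation yields b · y.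
  have eby : m b y = (1 / 4 - l) • y + (l - 4 * l ^ 2) • a + (3 * l) • b := by
    linear_combination (norm := module) hz
  have iay : ⟪a, y⟫_ℝ = 0 := inner_eq_zero_of_eigen hm ha (by norm_num) hy1
  have qy : quarterPart m a y = y := by
    rw [quarterPart_apply, hy1, iay]; module
  have qa : quarterPart m a a = 0 := by
    rw [quarterPart_apply, ha.idem, ha.inner_self]; simp
  rw [eby, hb.idem] at hy2
  rw [eby] at eyy
  simp only [map_add, map_smul, qy, qa, ← hy] at hy2 eyy
  -- The 1/4-part of b · y is (1/4 + 2l) y, and it must be half that of b · b = b.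
  have h3 : (2 * l - 1 / 4) • y = 0 := by linear_combination (norm := module) hy2
  rcases smul_eq_zero.1 h3 with h | h
  · left
    have l8 : l = 1 / 8 := by linarith
    subst l8
    have iby : ⟪b, y⟫_ℝ = 7 / 16 := by
      have := hm b b a
      rw [eba, hb.idem, hl', inner_add_right, inner_smul_right, inner_smul_right, hl'] at this
      linarith
    have iyy : ⟪y, y⟫_ℝ = 7 / 16 := by
      have := hm y a b
      rw [eab, hc y a, hy1, inner_add_right, inner_smul_right, inner_smul_right, real_inner_smul_left,
        real_inner_comm a y, real_inner_comm b y, iay, iby] at this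
      linarith
    have iaw : ⟪a, b - (2 : ℝ) • y⟫_ℝ = 1 / 2 ^ 3 := by
      rw [inner_sub_right, inner_smul_right, iay, ← hl]; norm_num
    have ibw : ⟪b, b - (2 : ℝ) • y⟫_ℝ = 1 / 2 ^ 3 := by
      rw [inner_sub_right, inner_smul_right, iby, hb.inner_self]; norm_num
    -- The third axis is the image of `b` under σ(a), which negates the 1/4-part `y`.
    refine ⟨b - (2 : ℝ) • y, ?_, ?_, ?_, ha.idem, hb.idem, ?_, ?_, iaw, ibw, ha.inner_self,
      hb.inner_self, ?_⟩
    · rw [eab]; module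
    · rw [map_sub, map_smul, eab, hy1]; module
    · rw [map_sub, map_smul, hb.idem, eby]; module
    · simp only [map_sub, map_smul, LinearMap.sub_apply, LinearMap.smul_apply, hc y b, hb.idem,
        eby, eyy]
      module
    · rw [← hl]; norm_num
    · rw [inner_sub_left, inner_smul_left, ibw, inner_sub_right, inner_smul_right,
        real_inner_comm b y, iby, iyy]
      norm_num
  · right
    rw [h, smul_zero, add_zero] at eab
    have e := hm a a b
    rw [ha.idem, eab, inner_smul_right, ha.inner_self, ← hl] at e
    have := hm b a b
    rw [eba, eab, h, smul_zero, add_zero, inner_smul_right, inner_smul_left, ← hl, hl'] at this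
    have hb' := hm a b b
    rw [eab, hb.idem, inner_smul_left, ← hl] at hb'
    have : l * (l - 1) = 0 := by simp at hb'; nlinarith
    rcases mul_eq_zero.1 this with h | h
    · rw [eab, h, zero_smul]
    · exact absurd (by rw [← hl]; linarith) (ha.inner_ne_one hb hab)

/-- Two distinct axes whose involutions generate a group of order `6` have inner product
`13 / 2^8` or `1 / 2^6`. -/
theorem inner_of_order_three (hm : ∀ u v w, ⟪u, m v w⟫_ℝ = ⟪m u v, w⟫_ℝ)
    (hc : ∀ u v, m u v = m v u) {a₀ a₁ a₂ : V} {τ₀ τ₁ τ₂ : V →ₗ[ℝ] V}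
    (h₀ : IsAxis m a₀) (h₁ : IsAxis m a₁) (h₂ : IsAxis m a₂) (hτ₀ : IsTau m a₀ τ₀)
    (hτ₁ : IsTau m a₁ τ₁) (hτ₂ : IsTau m a₂ τ₂) (h01 : τ₀ a₁ = a₂) (h02 : τ₀ a₂ = a₁)
    (h10 : τ₁ a₀ = a₂) (h12 : τ₁ a₂ = a₀) (h20 : τ₂ a₀ = a₁) (h21 : τ₂ a₁ = a₀)
    (hne : a₀ ≠ a₁) : ⟪a₀, a₁⟫_ℝ = 13 / 256 ∨ ⟪a₀, a₁⟫_ℝ = 1 / 64 := by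
  obtain ⟨s, hs⟩ : ∃ s, s = sVec m a₀ a₁ := ⟨_, rfl⟩
  have s02 : sVec m a₀ a₂ = s := by rw [← h01, hτ₀.sVec_eq h₀, hs]
  have s10 : sVec m a₁ a₀ = s := by rw [sVec_comm hc, hs]
  have s12 : sVec m a₁ a₂ = s := by rw [← h10, hτ₁.sVec_eq h₁, s10]
  have s20 : sVec m a₂ a₀ = s := by rw [sVec_comm hc, s02]
  have s21 : sVec m a₂ a₁ = s := by rw [sVec_comm hc, s12]
  obtain ⟨l, hl⟩ : ∃ l, l = ⟪a₀, a₁⟫_ℝ := ⟨_, rfl⟩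
  have l02 : ⟪a₀, a₂⟫_ℝ = l := by rw [← h01, hτ₀.inner_eq hm h₀, hl]
  have l10 : ⟪a₁, a₀⟫_ℝ = l := by rw [real_inner_comm, hl]
  have l12 : ⟪a₁, a₂⟫_ℝ = l := by rw [← h10, hτ₁.inner_eq hm h₁, l10]
  have l20 : ⟪a₂, a₀⟫_ℝ = l := by rw [real_inner_comm, l02]
  have m1s := hτ₁.mul_sVec hm h₁ (b := a₀) (by rw [h10, h12])
  have m2s := hτ₂.mul_sVec hm h₂ (b := a₀) (by rw [h20, h21])
  rw [s10, h10, l10] at m1s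
  rw [s20, h20, l20] at m2s
  have fix : τ₀ (a₁ + a₂) = a₁ + a₂ := by rw [map_add, h01, h02, add_comm]
  have q := hτ₀.quarterPart_add hm h₀ a₁
  rw [h01, ← hs, ← hl] at q
  obtain ⟨y, hy⟩ : ∃ y, y = quarterPart m a₀ (a₁ + a₂) := ⟨_, rfl⟩
  have hy1 := (hτ₀.mul_quarterPart hm h₀ fix).1
  have hy2 := (hτ₀.quarterPart_mul_quarterPart hm hc h₀ fix).1
  have qa : quarterPart m a₀ a₀ = 0 := by
    rw [quarterPart_apply, h₀.idem, h₀.inner_self]; simp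
  have qy : quarterPart m a₀ y = y := by
    rw [quarterPart_apply, hy, hy1, inner_eq_zero_of_eigen hm h₀ (by norm_num) hy1]; module
  -- The 1/4-part of `y` is `y`, that of a₀ is 0 and that of a₁ + a₂ is `y`, so y = 8 q(s) + y/8.
  have qs : quarterPart m a₀ s = (7 / 64 : ℝ) • y := by
    have h := qy
    rw [hy, q] at h
    simp only [map_add, map_smul, qa] at h
    rw [← map_add, q] at h
    rw [hy, q]
    linear_combination (norm := module) (1 / 8 : ℝ) • h
  rw [← hy] at hy2 q
  have eww : m (a₁ + a₂) (a₁ + a₂) = (17 / 16 : ℝ) • (a₁ + a₂) + (2 : ℝ) • s := by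
    simp only [map_add, LinearMap.add_apply, h₁.idem, h₂.idem, mul_eq_sVec a₁ a₂,
      mul_eq_sVec a₂ a₁, s12, s21]
    module
  have e0w : m (a₁ + a₂) a₀ = (2 : ℝ) • s + (1 / 16 : ℝ) • a₀ + (1 / 32 : ℝ) • (a₁ + a₂) := by
    simp only [map_add, LinearMap.add_apply, mul_eq_sVec a₁ a₀, mul_eq_sVec a₂ a₀, s10, s20]
    module
  have esw : m (a₁ + a₂) s = (7 / 16 : ℝ) • s + (3 / 4 * l - 43 / 2048) • (a₁ + a₂) +
      (7 / 1024 : ℝ) • a₀ := by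
    rw [map_add, LinearMap.add_apply, m1s, m2s]
    module
  have ewa : ⟪a₀, a₁ + a₂⟫_ℝ - ⟪a₁, a₁ + a₂⟫_ℝ = l - 1 := by
    rw [inner_add_right, inner_add_right, l02, l12, ← hl, h₁.inner_self]; ring
  generalize a₁ + a₂ = w at *
  rw [q, map_add (m w), map_add (m w), map_smul, map_smul, map_smul, eww, e0w, esw] at hy2
  simp only [map_add, map_smul, qa, qs, ← hy] at hy2
  have h3 : (4 * l - 13 / 64) • y = 0 := by linear_combination (norm := module) hy2
  -- The first case is the 3A value. If `y` = 0, pairing `y` with a₀ and a₁ gives the 3C value,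
  -- since `s` pairs equally with both.
  rcases smul_eq_zero.1 h3 with h | h
  · left; rw [← hl]; linarith
  · right
    have is : ⟪a₀, s⟫_ℝ = ⟪a₁, s⟫_ℝ := by
      rw [hs, sVec, inner_sub_right, inner_sub_right, hm, hm, hc a₁ a₀, h₀.idem,
        ← hm a₀ a₁ a₁, h₁.idem]
      simp only [inner_smul_right, inner_add_right, l10, ← hl, h₀.inner_self, h₁.inner_self]
      ring
    have e0 : ⟪a₀, y⟫_ℝ - ⟪a₁, y⟫_ℝ = 0 := by rw [h]; simp
    rw [q] at e0
    simp only [inner_add_right, inner_smul_right, l10, h₀.inner_self, is] at e0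
    have h4 : (1 - l) * (1 / 8 - 8 * l) = 0 := by linear_combination e0 - 1 / 8 * ewa
    rcases mul_eq_zero.1 h4 with h5 | h5
    · exact absurd (by rw [← hl]; linarith) (h₀.inner_ne_one h₁ hne)
    · rw [← hl]; linarith

/-- Six axes `a₀, …, a₅` permuted dihedrally by their involutions cannot have opposite members
with product zero. -/
theorem false_of_hexagon (hm : ∀ u v w, ⟪u, m v w⟫_ℝ = ⟪m u v, w⟫_ℝ)
    (hc : ∀ u v, m u v = m v u) (hn : ∀ u v, ⟪m u v, m u v⟫_ℝ ≤ ⟪m u u, m v v⟫_ℝ)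
    {a₀ a₁ a₂ a₃ a₄ a₅ : V} {τ₀ τ₁ τ₂ τ₃ τ₄ : V →ₗ[ℝ] V}
    (h₀ : IsAxis m a₀) (h₁ : IsAxis m a₁) (h₂ : IsAxis m a₂) (h₃ : IsAxis m a₃)
    (h₄ : IsAxis m a₄) (hτ₀ : IsTau m a₀ τ₀) (hτ₁ : IsTau m a₁ τ₁) (hτ₂ : IsTau m a₂ τ₂)
    (hτ₃ : IsTau m a₃ τ₃) (hτ₄ : IsTau m a₄ τ₄)
    (h01 : τ₀ a₁ = a₅) (h02 : τ₀ a₂ = a₄) (h04 : τ₀ a₄ = a₂) (h05 : τ₀ a₅ = a₁)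
    (hmul : ∀ u v, m (τ₀ u) (τ₀ v) = τ₀ (m u v)) (h10 : τ₁ a₀ = a₂)
    (h20 : τ₂ a₀ = a₄) (h21 : τ₂ a₁ = a₃) (h24 : τ₂ a₄ = a₀)
    (h31 : τ₃ a₁ = a₅) (h32 : τ₃ a₂ = a₄) (h34 : τ₃ a₄ = a₂)
    (h40 : τ₄ a₀ = a₂) (h42 : τ₄ a₂ = a₀)
    (hne : a₀ ≠ a₂) (p03 : m a₀ a₃ = 0) (p25 : m a₂ a₅ = 0) : False := by
  have p30 : m a₃ a₀ = 0 := by rw [hc, p03]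
  obtain ⟨s, hs⟩ : ∃ s, s = sVec m a₀ a₁ := ⟨_, rfl⟩
  obtain ⟨e, he⟩ : ∃ e, e = sVec m a₀ a₂ := ⟨_, rfl⟩
  obtain ⟨o, ho⟩ : ∃ o, o = sVec m a₃ a₁ := ⟨_, rfl⟩
  have s21 : sVec m a₂ a₁ = s := by
    rw [sVec_comm hc, ← h10, hτ₁.sVec_eq h₁, sVec_comm hc, hs]
  have s32 : sVec m a₃ a₂ = s := by
    rw [sVec_comm hc, ← h21, hτ₂.sVec_eq h₂, s21]
  have s05 : sVec m a₀ a₅ = s := by rw [← h01, hτ₀.sVec_eq h₀, hs]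
  have e04 : sVec m a₀ a₄ = e := by rw [← h02, hτ₀.sVec_eq h₀, he]
  have o35 : sVec m a₃ a₅ = o := by rw [← h31, hτ₃.sVec_eq h₃, ho]
  obtain ⟨l, hl⟩ : ∃ l, l = ⟪a₀, a₁⟫_ℝ := ⟨_, rfl⟩
  obtain ⟨k, hk⟩ : ∃ k, k = ⟪a₀, a₂⟫_ℝ := ⟨_, rfl⟩
  have l05 : ⟪a₀, a₅⟫_ℝ = l := by rw [← h01, hτ₀.inner_eq hm h₀, hl]
  have l21 : ⟪a₂, a₁⟫_ℝ = l := by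
    rw [real_inner_comm, ← h10, hτ₁.inner_eq hm h₁, real_inner_comm, hl]
  have l23 : ⟪a₂, a₃⟫_ℝ = l := by rw [← h21, hτ₂.inner_eq hm h₂, l21]
  have l32 : ⟪a₃, a₂⟫_ℝ = l := by rw [real_inner_comm, l23]
  have k04 : ⟪a₀, a₄⟫_ℝ = k := by rw [← h02, hτ₀.inner_eq hm h₀, hk]
  have k20 : ⟪a₂, a₀⟫_ℝ = k := by rw [real_inner_comm, hk]
  have k24 : ⟪a₂, a₄⟫_ℝ = k := by rw [← h20, hτ₂.inner_eq hm h₂, k20]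
  have i03 : ⟪a₀, a₃⟫_ℝ = 0 := by
    have := hm a₀ a₀ a₃
    rwa [p03, inner_zero_right, h₀.idem, eq_comm] at this
  have i25 : ⟪a₂, a₅⟫_ℝ = 0 := by
    have := hm a₂ a₂ a₅
    rwa [p25, inner_zero_right, h₂.idem, eq_comm] at this
  have fixs : τ₀ s = s := by
    have h00 : τ₀ a₀ = a₀ := hτ₀.one a₀ (mem_eig.2 (by simpa using h₀.idem))
    nth_rewrite 1 [hs]
    rw [sVec, map_sub, ← hmul, map_smul, map_add, h00, h01, ← s05, sVec]
  have m0s := hτ₀.mul_sVec hm h₀ (b := a₁) (by rw [h01, h05])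
  have m3s := hτ₃.mul_sVec hm h₃ (b := a₂) (by rw [h32, h34])
  rw [← hs, h01, ← hl] at m0s
  rw [s32, h32, l32] at m3s
  -- a₃ is a 0-eigenvector of a₀ and `s` is fixed by τ₀, so a₀(a₃s) = a₃(a₀s). Both sides expand
  -- into axes, `s`, `e` and `o`, and the terms in `s` cancel.
  have comm := hτ₀.mul_mul_comm hm hc h₀ p03 fixs
  rw [m0s, m3s] at comm
  simp only [map_add, map_smul, m0s, m3s, p03, p30, mul_eq_sVec a₀ a₂, mul_eq_sVec a₀ a₄,
    mul_eq_sVec a₃ a₁, mul_eq_sVec a₃ a₅, ← he, e04, ← ho, o35] at comm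
  have i0e : ⟪a₀, e⟫_ℝ = (31 * k - 1) / 32 := by
    rw [he, sVec, inner_sub_right, hm, h₀.idem, inner_smul_right, inner_add_right, h₀.inner_self,
      ← hk]
    ring
  have i2e : ⟪a₂, e⟫_ℝ = (31 * k - 1) / 32 := by
    rw [he, sVec, inner_sub_right, hc, hm, h₂.idem, inner_smul_right, inner_add_right,
      h₂.inner_self, k20]
    ring
  have i0o : ⟪a₀, o⟫_ℝ = - l / 32 := by
    rw [ho, sVec, inner_sub_right, hm, p03, inner_smul_right, inner_add_right, i03, ← hl,
      inner_zero_left]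
    ring
  have i2o : ⟪a₂, o⟫_ℝ = - l / 32 := by
    rw [← o35, sVec, inner_sub_right, hc, hm, p25, inner_smul_right, inner_add_right, i25, l23,
      inner_zero_left]
    ring
  have c0 := congrArg (fun x => ⟪a₀, x⟫_ℝ) comm
  have c2 := congrArg (fun x => ⟪a₂, x⟫_ℝ) comm
  simp only [inner_add_right, inner_smul_right, inner_zero_right, i0e, i0o, i2e, i2o, i03, i25,
    ← hl, ← hk, l05, l21, l23, k04, k20, k24, h₀.inner_self, h₂.inner_self] at c0 c2
  have l0 : 0 ≤ l := hl ▸ h₀.inner_nonneg hn h₁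
  have k1 : k < 1 := hk ▸ h₀.inner_lt_one h₂ hne
  -- Pairing with a₀ and with a₂ and subtracting leaves this factorization; 1 - k + l is positive.
  have l1 : l = 7 / 256 := by
    have : (1 - k + l) * (l - 7 / 256) = 0 := by linear_combination (128 / 21) * (c0 - c2)
    rcases mul_eq_zero.1 this with h | h <;> linarith
  -- The even axes a₀, a₂, a₄ form a triangle, so k is 13/256 or 1/64; neither fits `c0` with l =
  -- 7/256.
  rcases inner_of_order_three hm hc h₀ h₂ h₄ hτ₀ hτ₂ hτ₄ h02 h04 h20 h24 h40 h42 hne with h | h <;>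
    rw [← hk] at h <;> rw [h, l1] at c0 <;> linarith

end Majorana

/-! ### Constraints on `T` imposed by a representation. -/

namespace MajoranaRepresentation

open Majorana

variable {G : Type*} [Group G] {T : Set G} {V : Type*} [NormedAddCommGroup V]
  [InnerProductSpace ℝ V] (R : MajoranaRepresentation G T V)
include R

theorem mul_self_eq_one {t : G} (ht : t ∈ T) : t * t = 1 := by
  rw [← pow_two, ← R.involution t ht, pow_orderOf_eq_one]

theorem φ_axis {t s u : T} (h : (t : G) * s * t = u) : R.φ t (R.ψ s) = R.ψ u := by
  rw [← R.ψ_conj t s]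
  congr 1
  refine Subtype.ext ?_
  change (t : G) * s * (t : G)⁻¹ = u
  rw [← h, inv_eq_of_mul_eq_one_left (R.mul_self_eq_one t.2)]

theorem conj_mem' {t s : G} (ht : t ∈ T) (hs : s ∈ T) : t * s * t ∈ T := by
  have := R.conj_mem t s hs
  rwa [inv_eq_of_mul_eq_one_left (R.mul_self_eq_one ht)] at this

/-- Commuting involutions fix each other's axes, and (M8) turns type 2A into membership in `T`. -/
theorem mul_mem_or_mul_eq_zero {t s : G} (ht : t ∈ T) (hs : s ∈ T) (hne : t ≠ s)
    (hts : t * s = s * t) : t * s ∈ T ∨ R.mul (R.ψ ⟨t, ht⟩) (R.ψ ⟨s, hs⟩) = 0 := by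
  have h1 : R.φ t (R.ψ ⟨s, hs⟩) = R.ψ ⟨s, hs⟩ :=
    R.φ_axis (t := ⟨t, ht⟩) (by simp only; rw [hts, mul_assoc, R.mul_self_eq_one ht, mul_one])
  have h2 : R.φ s (R.ψ ⟨t, ht⟩) = R.ψ ⟨t, ht⟩ :=
    R.φ_axis (t := ⟨s, hs⟩) (by simp only; rw [← hts, mul_assoc, R.mul_self_eq_one hs, mul_one])
  rcases type2A_or_type2B R.inner_assoc R.mul_comm (R.ψ_isAxis ⟨t, ht⟩) (R.ψ_isAxis ⟨s, hs⟩)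
    (R.φ_eq_tau ⟨t, ht⟩) (R.φ_eq_tau ⟨s, hs⟩)
    (fun h => hne (congrArg Subtype.val (R.ψ_injective h))) h1 h2 with ⟨w, hw⟩ | h
  · exact .inl (R.mem_of_type2A _ _ w hw).1
  · exact .inr h

/-- If `ts` has order `6`, the axes of `t` and `s` generate an algebra of type `6A`, whence
`(ts)^3 ∈ T`. -/
theorem pow_three_mem {t s : G} (ht : t ∈ T) (hs : s ∈ T) (hts : orderOf (t * s) = 6) :
    (t * s) ^ 3 ∈ T := by
  have tt := R.mul_self_eq_one ht
  have ss := R.mul_self_eq_one hs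
  have tt' : ∀ x, t * (t * x) = x := fun x => by rw [← mul_assoc, tt, one_mul]
  have ss' : ∀ x, s * (s * x) = x := fun x => by rw [← mul_assoc, ss, one_mul]
  have hpow : ∀ n, 0 < n → n < 6 → (t * s) ^ n ≠ 1 := fun n h0 h6 =>
    pow_ne_one_of_lt_orderOf h0.ne' (hts ▸ h6)
  have h6 : t * (s * (t * (s * (t * s)))) = s * (t * (s * (t * (s * t)))) := by
    have h := pow_orderOf_eq_one (t * s)
    rw [hts, show 6 = 3 + 3 from rfl, pow_add] at h
    have h' := eq_inv_of_mul_eq_one_left h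
    simp only [pow_succ, pow_zero, one_mul, mul_inv_rev, inv_eq_of_mul_eq_one_left tt,
      inv_eq_of_mul_eq_one_left ss, mul_assoc] at h'
    exact h'
  have h6' : ∀ x, s * (t * (s * (t * (s * (t * x))))) = t * (s * (t * (s * (t * (s * x))))) :=
    fun x => by simpa only [mul_assoc] using congrArg (· * x) h6.symm
  -- The hexagon is t, s, sts, ststs, tstst, tst; the opposite pair t, ststs has product (ts)^3.
  have g2 := R.conj_mem' hs ht
  have g5 := R.conj_mem' ht hs
  have g4 := R.conj_mem' ht g2
  have g3 := R.conj_mem' hs g5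
  have e03 : t * (s * (t * s * t) * s) = (t * s) ^ 3 := by
    simp only [pow_succ, pow_zero, one_mul, mul_assoc]
  by_contra hcon
  have p03 := (R.mul_mem_or_mul_eq_zero ht g3 (by
      intro h
      refine hpow 3 (by norm_num) (by norm_num) ?_
      rw [← e03, ← h, tt]) (by
      simp only [mul_assoc]; exact h6)).resolve_left (by rwa [e03])
  -- Conjugation by `s` carries the opposite pair a₀, a₃ to a₂, a₅.
  have p25 : R.mul (R.ψ ⟨_, g2⟩) (R.ψ ⟨_, g5⟩) = 0 := by
    rw [← R.φ_axis (t := ⟨s, hs⟩) (s := ⟨t, ht⟩) (u := ⟨_, g2⟩) rfl, ← R.φ_axis (t := ⟨s, hs⟩) (s := ⟨_, g3⟩) (u := ⟨_, g5⟩)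
        (by simp only [mul_assoc, ss', ss, mul_one]),
      R.φ_mul, p03, map_zero]
  refine false_of_hexagon R.inner_assoc R.mul_comm R.norton
    (R.ψ_isAxis ⟨_, ht⟩) (R.ψ_isAxis ⟨_, hs⟩) (R.ψ_isAxis ⟨_, g2⟩) (R.ψ_isAxis ⟨_, g3⟩)
    (R.ψ_isAxis ⟨_, g4⟩) (R.φ_eq_tau ⟨_, ht⟩) (R.φ_eq_tau ⟨_, hs⟩) (R.φ_eq_tau ⟨_, g2⟩)
    (R.φ_eq_tau ⟨_, g3⟩) (R.φ_eq_tau ⟨_, g4⟩) (a₅ := R.ψ ⟨_, g5⟩)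
    (R.φ_axis ?_) (R.φ_axis ?_) (R.φ_axis ?_) (R.φ_axis ?_)
    (R.φ_mul _) (R.φ_axis ?_) (R.φ_axis ?_) (R.φ_axis ?_)
    (R.φ_axis ?_) (R.φ_axis ?_) (R.φ_axis ?_) (R.φ_axis ?_)
    (R.φ_axis ?_) (R.φ_axis ?_) ?_ p03 p25
  all_goals try simp only [mul_assoc, tt', ss', tt, ss, mul_one, h6', h6.symm]
  intro h
  have h : t = s * (t * s) := congrArg Subtype.val (R.ψ_injective h)
  refine hpow 2 (by norm_num) (by norm_num) ?_
  rw [pow_two, mul_assoc, ← h, tt]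

/-- There are no three commuting involutions in `T` generating a group of order `8` whose
involutions are all in `T`. -/
theorem false_of_elementary_abelian {u v w : G} (hu : u ∈ T) (hv : v ∈ T) (hw : w ∈ T)
    (huv : u * v ∈ T) (huw : u * w ∈ T) (hvw : v * w ∈ T) (huvw : u * v * w ∈ T)
    (cuv : u * v = v * u) : False := by
  have type : ∀ {x y z : G} (hx : x ∈ T) (hy : y ∈ T) (hz : z ∈ T), x * y = z →
      IsType2A R.mul (R.ψ ⟨x, hx⟩) (R.ψ ⟨y, hy⟩) (R.ψ ⟨z, hz⟩) := fun hx hy hz h =>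
    R.type2A_of_mul_eq_one ⟨_, hx⟩ ⟨_, hy⟩ ⟨_, hz⟩ (by
      simp only; rw [h, R.mul_self_eq_one hz])
  have e1 := type hu hv huv rfl
  have e2 := type hu hw huw rfl
  have e3 := type hu hvw huvw (mul_assoc _ _ _).symm
  have e4 := type hv hw hvw rfl
  have e5 := type hv huw huvw (by rw [← mul_assoc, ← cuv])
  have e6 := type huv hw huvw rfl
  have e7 := type huv huw hvw (by
    rw [cuv, mul_assoc, ← mul_assoc u, R.mul_self_eq_one hu, one_mul])
  have q : ∀ {x y z : V}, IsType2A R.mul x y z →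
      R.mul x (y - z) = (1 / 4 : ℝ) • (y - z) := fun {x y z} h => by
    rw [map_sub, h.mul_01, h.mul_0ρ]; module
  have hprod : R.mul (R.ψ ⟨v, hv⟩ - R.ψ ⟨_, huv⟩) (R.ψ ⟨w, hw⟩ - R.ψ ⟨_, huw⟩) =
      (-1 / 4 : ℝ) • (R.ψ ⟨_, hvw⟩ - R.ψ ⟨_, huvw⟩) := by
    simp only [map_sub, LinearMap.sub_apply, e4.mul_01, e5.mul_01, e6.mul_01, e7.mul_01]
    module
  -- The product of two 1/4-eigenvectors of ψ(u) is again one, so it vanishes.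
  have h0 := (R.ψ_isAxis ⟨u, hu⟩).mul_eq_zero_of_quarter R.inner_assoc (q e1) (q e2)
    (by rw [hprod, map_smul, q e3, smul_comm])
  rw [hprod] at h0
  have h1 := sub_eq_zero.1 ((smul_eq_zero.1 h0).resolve_left (by norm_num))
  have h2 : v * w = u * v * w := congrArg Subtype.val (R.ψ_injective h1)
  have h3 : u = 1 := by rw [mul_assoc] at h2; exact (mul_eq_right.1 h2.symm)
  have := R.involution u hu
  rw [h3, orderOf_one] at this
  norm_num at this

end MajoranaRepresentation

/-! ### The group `2 × (3^{1+2}_+ : 2^2)` -/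

/-- The complement `2 × 2^2` to `3^{1+2}_+`. -/
abbrev TwoTimesKlein : Type := Multiplicative (ZMod 2) × ((ZMod 3)ˣ × (ZMod 3)ˣ)

namespace TwoTimesHeisKlein

/-- The embedding of the complement. -/
def lift : TwoTimesKlein →* TwoTimesHeisKlein :=
  MonoidHom.prodMap (MonoidHom.id _) SemidirectProduct.inr

/-- The projection with kernel `3^{1+2}_+`. -/
def proj : TwoTimesHeisKlein →* TwoTimesKlein :=
  MonoidHom.prodMap (MonoidHom.id _) SemidirectProduct.rightHom

/-- The element with projection `q` and Heisenberg part `(x, y, z)`. -/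
def mk (q : TwoTimesKlein) (x y z : ZMod 3) : TwoTimesHeisKlein := (q.1, ⟨⟨x, y, z⟩, q.2⟩)

theorem mk_eta (g : TwoTimesHeisKlein) :
    mk (proj g) g.2.left.x g.2.left.y g.2.left.z = g := rfl

theorem proj_lift (q : TwoTimesKlein) : proj (lift q) = q := rfl

theorem lift_injective : Function.Injective lift := fun p q h => by
  rw [← proj_lift p, h, proj_lift]

theorem proj_surjective : Function.Surjective proj := fun q => ⟨lift q, rfl⟩

theorem complement_mul_self : ∀ q : TwoTimesKlein, q * q = 1 := by decide

set_option maxRecDepth 100000 in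
theorem pow_six (g : TwoTimesHeisKlein) : g ^ 6 = 1 := by
  have : ∀ (q : TwoTimesKlein) (x y z : ZMod 3), mk q x y z ^ 6 = 1 := by decide
  rw [← mk_eta g, this]

set_option maxRecDepth 100000 in
/-- An involution is conjugate to its image in the complement. -/
theorem exists_conj_eq_lift (g : TwoTimesHeisKlein) (hg : g * g = 1) :
    ∃ h, h * g * h⁻¹ = lift (proj g) := by
  have : ∀ (q : TwoTimesKlein) (x y z : ZMod 3), mk q x y z * mk q x y z = 1 →
      ∃ x' y' z', mk 1 x' y' z' * mk q x y z * (mk 1 x' y' z')⁻¹ = lift q := by decide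
  obtain ⟨x, y, z, h⟩ := this (proj g) _ _ _ hg
  exact ⟨_, h⟩

set_option maxRecDepth 100000 in
set_option synthInstance.maxHeartbeats 400000 in
set_option synthInstance.maxSize 4000 in
/-- Commuting involutions are simultaneously conjugate to their images in the complement. -/
theorem exists_conj_eq_lift_of_commute (p : TwoTimesKlein) (g : TwoTimesHeisKlein)
    (hg : g * g = 1) (hpg : lift p * g = g * lift p) :
    ∃ h, h * lift p * h⁻¹ = lift p ∧ h * g * h⁻¹ = lift (proj g) := by
  have : ∀ (p q : TwoTimesKlein) (x y z : ZMod 3), mk q x y z * mk q x y z = 1 →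
      lift p * mk q x y z = mk q x y z * lift p →
      ∃ x' y' z', mk 1 x' y' z' * lift p * (mk 1 x' y' z')⁻¹ = lift p ∧
        mk 1 x' y' z' * mk q x y z * (mk 1 x' y' z')⁻¹ = lift q := by decide
  obtain ⟨x, y, z, h⟩ := this p (proj g) _ _ _ hg hpg
  exact ⟨_, h⟩

/-- The complement is abelian of exponent 2, so exponents 0 and 1 suffice. This makes generation a
decidable condition. -/
theorem exists_pow_of_closure_eq_top {α β γ : TwoTimesKlein}
    (h : Subgroup.closure {α, β, γ} = ⊤) (p : TwoTimesKlein) :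
    ∃ i j k : Fin 2, p = α ^ (i : ℕ) * β ^ (j : ℕ) * γ ^ (k : ℕ) := by
  have key : ∀ x ∈ ({α, β, γ} : Set TwoTimesKlein), ∀ p : TwoTimesKlein,
      (∃ i j k : Fin 2, p = α ^ (i : ℕ) * β ^ (j : ℕ) * γ ^ (k : ℕ)) →
      ∃ i j k : Fin 2, x * p = α ^ (i : ℕ) * β ^ (j : ℕ) * γ ^ (k : ℕ) := by
    have sq : ∀ (x : TwoTimesKlein) (i : Fin 2), ∃ j : Fin 2, x * x ^ (i : ℕ) = x ^ (j : ℕ) := by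
      intro x i
      fin_cases i
      · exact ⟨1, by simp⟩
      · exact ⟨0, by simp [complement_mul_self]⟩
    rintro x hx _ ⟨i, j, k, rfl⟩
    rcases hx with rfl | rfl | rfl
    · obtain ⟨i', e⟩ := sq x i
      exact ⟨i', j, k, by rw [← e]; simp only [mul_assoc]⟩
    · obtain ⟨j', e⟩ := sq x j
      exact ⟨i, j', k, by rw [← e]; simp only [mul_assoc, mul_left_comm]⟩
    · obtain ⟨k', e⟩ := sq x k
      exact ⟨i, j, k', by rw [← e]; simp only [mul_assoc, mul_left_comm]⟩
  have hp : p ∈ Subgroup.closure {α, β, γ} := h ▸ Subgroup.mem_top p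
  induction hp using Subgroup.closure_induction_left with
  | one => exact ⟨0, 0, 0, by simp⟩
  | mul_left x hx y _ ih => exact key x hx y ih
  | inv_mul_cancel x hx y _ ih =>
    rw [inv_eq_of_mul_eq_one_left (complement_mul_self x)]
    exact key x hx y ih

/-- The proper subgroup `{x = k (ε - 1)}`. -/
def xSubgroup (k : ZMod 3) : Subgroup TwoTimesHeisKlein where
  carrier := {g | g.2.left.x = k * ((g.2.right.1 : ZMod 3) - 1)}
  one_mem' := by simp
  mul_mem' {g h} hg hh := by
    change g.2.left.x + (g.2.right.1 : ZMod 3) * h.2.left.x =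
      k * ((g.2.right.1 : ZMod 3) * h.2.right.1 - 1)
    rw [hg, hh]; ring
  inv_mem' {g} hg := by
    have hu := Heis3.unit_mul_self g.2.right.1
    have hi : g.2.right.1⁻¹ = g.2.right.1 := by
      generalize g.2.right.1 = u; revert u; decide
    change ((g.2.right.1⁻¹ : (ZMod 3)ˣ) : ZMod 3) * -g.2.left.x =
      k * (((g.2.right.1⁻¹ : (ZMod 3)ˣ) : ZMod 3) - 1)
    rw [hi, hg]
    linear_combination -k * hu

/-- The proper subgroup `{y = k (δ - 1)}`. -/
def ySubgroup (k : ZMod 3) : Subgroup TwoTimesHeisKlein where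
  carrier := {g | g.2.left.y = k * ((g.2.right.2 : ZMod 3) - 1)}
  one_mem' := by simp
  mul_mem' {g h} hg hh := by
    change g.2.left.y + (g.2.right.2 : ZMod 3) * h.2.left.y =
      k * ((g.2.right.2 : ZMod 3) * h.2.right.2 - 1)
    rw [hg, hh]; ring
  inv_mem' {g} hg := by
    have hu := Heis3.unit_mul_self g.2.right.2
    have hi : g.2.right.2⁻¹ = g.2.right.2 := by
      generalize g.2.right.2 = u; revert u; decide
    change ((g.2.right.2⁻¹ : (ZMod 3)ˣ) : ZMod 3) * -g.2.left.y =
      k * (((g.2.right.2⁻¹ : (ZMod 3)ˣ) : ZMod 3) - 1)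
    rw [hi, hg]
    linear_combination -k * hu

theorem mem_xSubgroup {k : ZMod 3} {g : TwoTimesHeisKlein} :
    g ∈ xSubgroup k ↔ g.2.left.x = k * ((g.2.right.1 : ZMod 3) - 1) := Iff.rfl

theorem mem_ySubgroup {k : ZMod 3} {g : TwoTimesHeisKlein} :
    g ∈ ySubgroup k ↔ g.2.left.y = k * ((g.2.right.2 : ZMod 3) - 1) := Iff.rfl

theorem xSubgroup_ne_top (k : ZMod 3) : xSubgroup k ≠ ⊤ := fun h => by
  have : mk 1 1 0 0 ∈ xSubgroup k := h ▸ Subgroup.mem_top _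
  rw [mem_xSubgroup] at this
  clear h
  revert this; revert k; decide

theorem ySubgroup_ne_top (k : ZMod 3) : ySubgroup k ≠ ⊤ := fun h => by
  have : mk 1 0 1 0 ∈ ySubgroup k := h ▸ Subgroup.mem_top _
  rw [mem_ySubgroup] at this
  clear h
  revert this; revert k; decide

set_option maxRecDepth 100000 in
set_option synthInstance.maxHeartbeats 400000 in
set_option synthInstance.maxSize 4000 in
-- The hypotheses are the consequences of generation that suffice for the conclusions, in a form
-- open to enumeration.
theorem generators_finite_check : ∀ (q : TwoTimesKlein) (x y z : ZMod 3), x ≠ 0 → y ≠ 0 →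
    mk q x y z * mk q x y z = 1 → ∀ α β : TwoTimesKlein, ¬(α.2.1 = 1 ∧ β.2.1 = 1) →
    ¬(α.2.2 = 1 ∧ β.2.2 = 1) →
    (∀ p : TwoTimesKlein, ∃ i j k : Fin 2, p = α ^ (i : ℕ) * β ^ (j : ℕ) * q ^ (k : ℕ)) →
    (lift β * conjBy (mk q x y z) (lift α * mk q x y z)) ^ 3 = lift (β * q) ∧
    (lift α * mk q x y z) ^ 2 ≠ 1 ∧ (lift β * mk q x y z) ^ 2 ≠ 1 ∧
    (lift (α * β) * mk q x y z) ^ 2 ≠ 1 := by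
  unfold conjBy; decide

/-- Generation of the group by commuting involutions `α`, `β` of the complement and an
involution `c`. -/
theorem of_closure_eq_top {α β : TwoTimesKlein} {c : TwoTimesHeisKlein} (hc : c * c = 1)
    (h : Subgroup.closure {lift α, lift β, c} = ⊤) :
    Subgroup.closure {α, β, proj c} = ⊤ ∧
    (lift β * conjBy c (lift α * c)) ^ 3 = lift (β * proj c) ∧
    (lift α * c) ^ 2 ≠ 1 ∧ (lift β * c) ^ 2 ≠ 1 ∧ (lift (α * β) * c) ^ 2 ≠ 1 := by
  have hQ : Subgroup.closure {α, β, proj c} = ⊤ := by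
    have := congrArg (Subgroup.map proj) h
    rwa [MonoidHom.map_closure, Set.image_insert_eq, Set.image_pair, proj_lift, proj_lift,
      Subgroup.map_top_of_surjective _ proj_surjective] at this
  have hS : ∀ S : Subgroup TwoTimesHeisKlein, S ≠ ⊤ →
      ¬(lift α ∈ S ∧ lift β ∈ S ∧ c ∈ S) := by
    rintro S hS ⟨h1, h2, h3⟩
    refine hS (top_le_iff.1 (h ▸ (Subgroup.closure_le S).2 ?_))
    rintro _ (rfl | rfl | rfl) <;> assumption
  -- An involution with x ≠ 0 has ε = -1, and -2 = 1 in 𝔽₃.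
  have hu : ∀ (u : (ZMod 3)ˣ) (x : ZMod 3), x ≠ 0 → x + u * x = 0 → x = x * (u - 1) := by decide
  have hcx : c.2.left.x + c.2.right.1 * c.2.left.x = 0 := congrArg (fun g => g.2.left.x) hc
  have hcy : c.2.left.y + c.2.right.2 * c.2.left.y = 0 := congrArg (fun g => g.2.left.y) hc
  have hx : c.2.left.x ≠ 0 := fun h0 => hS (xSubgroup 0) (xSubgroup_ne_top 0) (by
    simp [mem_xSubgroup, h0, lift])
  have hy : c.2.left.y ≠ 0 := fun h0 => hS (ySubgroup 0) (ySubgroup_ne_top 0) (by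
    simp [mem_ySubgroup, h0, lift])
  refine ⟨hQ, generators_finite_check (proj c) _ _ _ hx hy hc α β ?_ ?_
    (exists_pow_of_closure_eq_top hQ)⟩
  -- G acts on 𝔽₃ by p ↦ εp + x, and `xSubgroup k` is the stabilizer of -k. If α and β act
  -- trivially, all three generators fix a point fixed by `c`.
  · rintro ⟨h1, h2⟩
    refine hS (xSubgroup c.2.left.x) (xSubgroup_ne_top _) ⟨?_, ?_, ?_⟩
    · simp [mem_xSubgroup, lift, h1]
    · simp [mem_xSubgroup, lift, h2]
    · exact hu _ _ hx hcx
  · rintro ⟨h1, h2⟩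
    refine hS (ySubgroup c.2.left.y) (ySubgroup_ne_top _) ⟨?_, ?_, ?_⟩
    · simp [mem_ySubgroup, lift, h1]
    · simp [mem_ySubgroup, lift, h2]
    · exact hu _ _ hy hcy

end TwoTimesHeisKlein

/-! ### Transport to an arbitrary group isomorphic to the model. -/

namespace TwoTimesHeisKlein

/-- The elementary abelian group of order `8` as a complement. -/
def elementaryAbelianHom : Multiplicative (Fin 3 → ZMod 2) →* TwoTimesKlein where
  toFun w := (Multiplicative.ofAdd (w.toAdd 0),
    (if w.toAdd 1 = 0 then 1 else -1, if w.toAdd 2 = 0 then 1 else -1))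
  map_one' := by decide
  map_mul' := by decide

theorem elementaryAbelianHom_bijective : Function.Bijective elementaryAbelianHom := by
  unfold Function.Bijective Function.Injective Function.Surjective
  decide

section

variable {G : Type*} [Group G] {a b c : G}

theorem mul_self_of_orderOf {g : G} (h : orderOf g = 2) : g * g = 1 := by
  rw [← pow_two, ← h, pow_orderOf_eq_one]

/-- The isomorphism can be chosen to map `a` and `b` into the complement. -/
theorem exists_equiv_lift (hG : Nonempty (G ≃* TwoTimesHeisKlein)) (ha : a * a = 1)
    (hb : b * b = 1) (hab : a * b = b * a) :
    ∃ (Φ : G ≃* TwoTimesHeisKlein) (α β : TwoTimesKlein), Φ a = lift α ∧ Φ b = lift β := by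
  obtain ⟨Φ⟩ := hG
  obtain ⟨h, e⟩ := exists_conj_eq_lift (Φ a) (by rw [← map_mul, ha, map_one])
  have e' : (Φ.trans (MulAut.conj h)) a = lift (proj (Φ a)) := e
  generalize Φ.trans (MulAut.conj h) = Ψ at e'
  generalize proj (Φ a) = α at e'
  obtain ⟨k, e1, e2⟩ := exists_conj_eq_lift_of_commute α (Ψ b) (by rw [← map_mul, hb, map_one])
    (by rw [← e', ← map_mul, hab, map_mul])
  refine ⟨Ψ.trans (MulAut.conj k), α, _, ?_, e2⟩
  change k * Ψ a * k⁻¹ = _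
  rw [e', e1]

variable {Φ : G ≃* TwoTimesHeisKlein} {α β : TwoTimesKlein} (ea : Φ a = lift α)
  (eb : Φ b = lift β) (hc : c * c = 1) (hgen : Subgroup.closure {a, b, c} = ⊤)
include ea eb hc hgen

theorem of_closure_eq_top' :
    Subgroup.closure {α, β, proj (Φ c)} = ⊤ ∧
    Φ ((b * conjBy c (a * c)) ^ 3) = lift (β * proj (Φ c)) ∧
    (a * c) ^ 2 ≠ 1 ∧ (b * c) ^ 2 ≠ 1 ∧ (a * b * c) ^ 2 ≠ 1 := by
  obtain ⟨h1, h2, h3, h4, h5⟩ := of_closure_eq_top (α := α) (β := β) (c := Φ c)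
    (by rw [← map_mul, hc, map_one]) (by
      rw [← ea, ← eb, ← Set.image_pair, ← Set.image_insert_eq]
      have := MonoidHom.map_closure Φ.toMonoidHom {a, b, c}
      rw [hgen, Subgroup.map_top_of_surjective _ Φ.surjective] at this
      exact this.symm)
  refine ⟨h1, ?_, fun h => h3 ?_, fun h => h4 ?_, fun h => h5 ?_⟩
  · rw [← h2, ← ea, ← eb]; simp [conjBy]
  all_goals have := congrArg Φ h; simpa [ea, eb] using this

/-- The third generator maps to the lift of βγ, with γ the projection of `c`, and α, β, βγ generate
the complement. -/
theorem map_closure_eq_range :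
    (Subgroup.closure {a, b, (b * conjBy c (a * c)) ^ 3}).map Φ.toMonoidHom = lift.range := by
  obtain ⟨h1, h2, -⟩ := of_closure_eq_top' ea eb hc hgen
  have h3 : Subgroup.closure {α, β, β * proj (Φ c)} = ⊤ := by
    rw [← top_le_iff, ← h1, Subgroup.closure_le]
    have hβ : β ∈ Subgroup.closure {α, β, β * proj (Φ c)} := Subgroup.subset_closure (by simp)
    rintro _ (rfl | rfl | rfl)
    · exact Subgroup.subset_closure (by simp)
    · exact hβ
    · exact (Subgroup.mul_mem_cancel_left _ hβ).1 (Subgroup.subset_closure (by simp))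
  rw [MonoidHom.map_closure, MonoidHom.range_eq_map, ← h3, MonoidHom.map_closure]
  simp only [Set.image_insert_eq, Set.image_singleton, ← h2, ← ea, ← eb]
  rfl

/-- Each q ≠ 1 is a product of some of α, β, γ. Without γ, or equal to γ, it is the image of a, b,
ab or c; otherwise it is the image of a cube. Conjugation then reaches the complement itself. -/
theorem symm_lift_mem {T : Set G} (haT : a ∈ T) (hbT : b ∈ T) (hcT : c ∈ T) (habT : a * b ∈ T)
    (hT : ∀ t ∈ T, ∀ g : G, conjBy t g ∈ T)
    (hT3 : ∀ t ∈ T, ∀ s ∈ T, orderOf (t * s) = 6 → (t * s) ^ 3 ∈ T)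
    (ha : a * a = 1) (hb : b * b = 1) (hab : a * b * (a * b) = 1)
    {q : TwoTimesKlein} (hq : q ≠ 1) : Φ.symm (lift q) ∈ T := by
  obtain ⟨h1, -, h3, h4, h5⟩ := of_closure_eq_top' ea eb hc hgen
  have hall := exists_pow_of_closure_eq_top h1
  have conj : ∀ t ∈ T, t * t = 1 → proj (Φ t) = q → Φ.symm (lift q) ∈ T := by
    intro t ht htt hpt
    obtain ⟨h, e⟩ := exists_conj_eq_lift (Φ t) (by rw [← map_mul, htt, map_one])
    have := hT t ht (Φ.symm h⁻¹)
    rw [← hpt, ← e]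
    simpa [conjBy] using this
  have cube : ∀ t ∈ T, (t * c) ^ 2 ≠ 1 → proj (Φ t) * proj (Φ c) = q → Φ.symm (lift q) ∈ T := by
    intro t ht h2 hpt
    have h6 : (t * c) ^ 6 = 1 := Φ.injective (by rw [map_pow, pow_six, map_one])
    have hp : proj (Φ ((t * c) ^ 3)) = q := by
      rw [map_pow, map_pow, map_mul, map_mul, hpt, pow_succ, pow_two, complement_mul_self, one_mul]
    -- The order of tc divides 6; it is exactly 6 because the square is not 1 and the cube projects
    -- to q ≠ 1.
    refine conj _ (hT3 t ht c hcT (orderOf_eq_of_pow_and_pow_div_prime (by norm_num) h6 ?_))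
      (by rw [← pow_add, h6]) hp
    intro p hpp hp6
    have : p = 2 ∨ p = 3 := by
      have := Nat.le_of_dvd (by norm_num) hp6
      interval_cases p <;> revert hpp hp6 <;> decide
    rcases this with rfl | rfl
    · intro h
      norm_num at h
      rw [h, map_one, map_one] at hp
      exact hq hp.symm
    · exact h2
  have pa : proj (Φ a) = α := by rw [ea, proj_lift]
  have pb : proj (Φ b) = β := by rw [eb, proj_lift]
  obtain ⟨i, j, k, hijk⟩ := hall q
  fin_cases i <;> fin_cases j <;> fin_cases k <;> simp at hijk
  · exact absurd hijk hq
  · exact conj c hcT hc hijk.symm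
  · exact conj b hbT hb (by rw [pb, hijk])
  · exact cube b hbT h4 (by rw [pb, hijk])
  · exact conj a haT ha (by rw [pa, hijk])
  · exact cube a haT h3 (by rw [pa, hijk])
  · exact conj (a * b) habT hab (by rw [map_mul, map_mul, pa, pb, hijk])
  · exact cube (a * b) habT h5 (by rw [map_mul, map_mul, pa, pb, hijk])

end

end TwoTimesHeisKlein

/-! ### The main theorem. -/

open TwoTimesHeisKlein in
theorem mainTheorem11 {G : Type*} [Group G] (hG : Nonempty (G ≃* TwoTimesHeisKlein))
    (a b c : G) (habc : IsTrianglePoint a b c)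
    (T : Set G) (ha : a ∈ T) (hb : b ∈ T) (hc : c ∈ T) (hab : a * b ∈ T) :
    (∀ (V : Type*) [NormedAddCommGroup V] [InnerProductSpace ℝ V],
      IsEmpty (MajoranaRepresentation G T V)) ∧
    Nonempty (Subgroup.closure {a, b, (b * conjBy c (a * c)) ^ 3} ≃*
      Multiplicative (Fin 3 → ZMod 2)) ∧
    ((∀ t ∈ T, ∀ g : G, conjBy t g ∈ T) →
      (∀ t ∈ T, ∀ s ∈ T, orderOf (t * s) = 6 → (t * s) ^ 3 ∈ T) →
      (Subgroup.closure {a, b, (b * conjBy c (a * c)) ^ 3} : Set G) ⊆ T ∪ {1}) := by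
  have haa := mul_self_of_orderOf habc.orderOf_a
  have hbb := mul_self_of_orderOf habc.orderOf_b
  have hcc := mul_self_of_orderOf habc.orderOf_c
  have habab := mul_self_of_orderOf habc.orderOf_ab
  have hcomm : a * b = b * a := by
    rw [eq_inv_of_mul_eq_one_left habab, mul_inv_rev, inv_eq_of_mul_eq_one_left haa,
      inv_eq_of_mul_eq_one_left hbb]
  obtain ⟨Φ, α, β, ea, eb⟩ := exists_equiv_lift hG haa hbb hcomm
  have hmap := map_closure_eq_range ea eb hcc habc.closure_eq_top
  refine ⟨fun V _ _ => ⟨fun R => ?_⟩, ?_, fun hT hT3 k hk => ?_⟩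
  -- A representation supplies both closure properties of `T`, so every nontrivial element of the
  -- complement lies in `T`.
  · have mem : ∀ q : TwoTimesKlein, q ≠ 1 → Φ.symm (lift q) ∈ T := fun q hq =>
      symm_lift_mem ea eb hcc habc.closure_eq_top ha hb hc hab
        (fun t ht g => by simpa [conjBy] using R.conj_mem g⁻¹ t ht)
        (fun t ht s hs h => R.pow_three_mem ht hs h) haa hbb habab hq
    let f : TwoTimesKlein →* G := Φ.symm.toMonoidHom.comp lift
    have mem' : ∀ q : TwoTimesKlein, q ≠ 1 → f q ∈ T := mem
    let u : TwoTimesKlein := (Multiplicative.ofAdd 1, 1)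
    let v : TwoTimesKlein := (1, (-1, 1))
    let w : TwoTimesKlein := (1, (1, -1))
    refine R.false_of_elementary_abelian (mem' u (by decide)) (mem' v (by decide))
      (mem' w (by decide)) ?_ ?_ ?_ ?_ (by rw [← map_mul, mul_comm, map_mul])
    all_goals simp only [← map_mul]; exact mem' _ (by decide)
  · exact ⟨((Subgroup.equivMapOfInjective _ Φ.toMonoidHom Φ.injective).trans
      (MulEquiv.subgroupCongr hmap)).trans ((MonoidHom.ofInjective lift_injective).symm.trans
        (MulEquiv.ofBijective _ elementaryAbelianHom_bijective).symm)⟩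
  · have : Φ k ∈ lift.range := hmap ▸ Subgroup.mem_map_of_mem Φ.toMonoidHom hk
    obtain ⟨q, hq⟩ := this
    by_cases h1 : q = 1
    · right
      rw [h1, map_one] at hq
      exact Φ.injective (by rw [← hq, map_one])
    · left
      have := symm_lift_mem ea eb hcc habc.closure_eq_top ha hb hc hab hT hT3 haa hbb habab h1
      rwa [hq, Φ.symm_apply_apply] at this
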